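/- Let $k$ be a field, $n \ge 0$, and $k[X] = k[x_1,\dots,x_n]$. A \emph{monomial preorder} is a strict partial order $<$ on the monomials $x^a$ ($a \in \mathbb{N}^n$) for which incomparability is an equivalence relation and such that, for all $a,b,c \in \mathbb{N}^n$, $x^a < x^b$ if and only if $x^a x^c < x^b x^c$. For a polynomial $f = \sum_a c_a x^a$, let its \emph{leading part} $L_<(f)$ be the sum of those terms $c_a x^a$ with $c_a \ne 0$ for which there is no $b$ with $c_b \neq 0$ and $x^a < x^b$. Let $<$ be an arbitrary monomial preorder. The set $S_< = \{u \in k[X] \mid L_<(u) = 1\}$ is multiplicatively closed; put $k[X]_< = S_<^{-1}k[X]$. For $f \in k[X]_<$ put $L_<(f) = L_<(uf)$ for any $u \in S_<$ with $uf \in k[X]$; this does not depend on the choice of $u$. For a subset $G \subseteq k[X]_<$, the \emph{leading ideal} $L_<(G)$ is the ideal of $k[X]$ generated by the elements $L_<(f)$, $f \in G$. A \emph{standard basis} of an ideal $I$ of $k[X]_<$ is a finite set $G \subseteq I$ with $L_<(G) = L_<(I)$. Then: (1) If $J \subseteq I$ are ideals of $k[X]_<$ with $L_<(J) = L_<(I)$,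 then $J = I$. (2) If $G$ is a standard basis of an ideal $I$ of $k[X]_<$, then $G$ generates $I$ as an ideal of $k[X]_<$. -/

import Mathlib

/-- A monomial preorder on the monomials in `n` indeterminates, a monomial `x^a` being identified
with its exponent vector `a`: a strict partial order whose incomparability relation is transitive
(a weak order), compatible and cancellative with the multiplication of monomials. -/
structure IsMonomialPreorder {n : ℕ} (lt : (Fin n →₀ ℕ) → (Fin n →₀ ℕ) → Prop) : Prop where
  weakOrder : IsStrictWeakOrder (Fin n →₀ ℕ) lt
  compatible : ∀ a b c : Fin n →₀ ℕ, lt a b → lt (a + c) (b + c)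
  cancellative : ∀ a b c : Fin n →₀ ℕ, lt (a + c) (b + c) → lt a b

namespace MonomialPreorder

open Classical in
/-- The leading part of a polynomial `f`: the sum of those terms of `f` whose monomials are
maximal among the monomials of `f`. -/
noncomputable def leadingPart {n : ℕ} {k : Type*} [Field k]
    (lt : (Fin n →₀ ℕ) → (Fin n →₀ ℕ) → Prop) (f : MvPolynomial (Fin n) k) :
    MvPolynomial (Fin n) k :=
  ∑ a ∈ f.support with ∀ b ∈ f.support, ¬ lt a b, MvPolynomial.monomial a (f.coeff a)

open Classical in
theorem coeff_leadingPart {n : ℕ} {k : Type*} [Field k]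
    (lt : (Fin n →₀ ℕ) → (Fin n →₀ ℕ) → Prop) (f : MvPolynomial (Fin n) k) (c : Fin n →₀ ℕ) :
    (leadingPart lt f).coeff c = if ∀ b ∈ f.support, ¬ lt c b then f.coeff c else 0 := by
  rw [leadingPart, MvPolynomial.coeff_sum]
  simp only [MvPolynomial.coeff_monomial]
  rw [Finset.sum_ite_eq']
  by_cases h : ∀ b ∈ f.support, ¬ lt c b
  · by_cases hc : c ∈ f.support
    · rw [if_pos (Finset.mem_filter.2 ⟨hc, h⟩), if_pos h]
    · rw [if_neg (fun h' => hc (Finset.mem_filter.1 h').1), if_pos h]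
      exact (MvPolynomial.notMem_support_iff.1 hc).symm
  · rw [if_neg (fun h' => h (Finset.mem_filter.1 h').2), if_neg h]

/-- Every monomial of `f` that is not maximal lies below a maximal one. -/
theorem exists_maximal_of_lt {n : ℕ} {lt : (Fin n →₀ ℕ) → (Fin n →₀ ℕ) → Prop}
    (h : IsMonomialPreorder lt) (s : Finset (Fin n →₀ ℕ)) {c b : Fin n →₀ ℕ}
    (hb : b ∈ s) (hcb : lt c b) : ∃ m ∈ s, lt c m ∧ ∀ d ∈ s, ¬ lt m d := by
  classical
  have := h.weakOrder
  obtain ⟨m, hm, hmax⟩ := (s.filter (fun d => lt c d)).finite_toSet.wellFoundedOn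
    (r := fun x y => lt y x) |>.has_min Set.univ
      ⟨⟨b, Finset.mem_coe.2 (Finset.mem_filter.2 ⟨hb, hcb⟩)⟩, trivial⟩
  have hm' := Finset.mem_filter.1 (Finset.mem_coe.1 m.2)
  refine ⟨m, hm'.1, hm'.2, fun d hd hmd => ?_⟩
  exact hmax ⟨d, Finset.mem_coe.2 (Finset.mem_filter.2 ⟨hd, _root_.trans hm'.2 hmd⟩)⟩ trivial hmd

theorem leadingPart_eq_one_iff {n : ℕ} {k : Type*} [Field k]
    {lt : (Fin n →₀ ℕ) → (Fin n →₀ ℕ) → Prop} (h : IsMonomialPreorder lt)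
    (u : MvPolynomial (Fin n) k) :
    leadingPart lt u = 1 ↔ u.coeff 0 = 1 ∧ ∀ a ∈ u.support, a ≠ 0 → lt a 0 := by
  classical
  have := h.weakOrder
  have key : leadingPart lt u = 1 ↔ ∀ c, (if ∀ b ∈ u.support, ¬ lt c b then u.coeff c else 0)
      = if 0 = c then 1 else 0 := by
    rw [MvPolynomial.ext_iff]
    simp only [coeff_leadingPart, MvPolynomial.coeff_one]
  rw [key]
  constructor
  · intro H
    have hmax : ∀ m ∈ u.support, (∀ d ∈ u.support, ¬ lt m d) → m = 0 := by
      intro m hm hmx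
      have := H m
      rw [if_pos hmx] at this
      by_contra hne
      rw [if_neg (Ne.symm hne)] at this
      exact MvPolynomial.mem_support_iff.1 hm this
    constructor
    · have := H 0
      rw [if_pos rfl] at this
      split_ifs at this with h0
      · exact this
      · exact absurd this zero_ne_one
    · intro a ha hne
      have : ¬ ∀ b ∈ u.support, ¬ lt a b := fun hc => hne (hmax a ha hc)
      push Not at this
      obtain ⟨b, hb, hab⟩ := this
      obtain ⟨m, hm, ham, hmx⟩ := exists_maximal_of_lt h u.support hb hab
      rwa [hmax m hm hmx] at ham
  · rintro ⟨h1, h2⟩ c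
    have h0 : (0 : Fin n →₀ ℕ) ∈ u.support := by
      rw [MvPolynomial.mem_support_iff, h1]; exact one_ne_zero
    by_cases hc : 0 = c
    · subst hc
      rw [if_pos rfl, if_pos, h1]
      intro b hb hlt
      by_cases hb0 : b = 0
      · subst hb0; exact irrefl _ hlt
      · exact irrefl _ (_root_.trans hlt (h2 b hb hb0))
    · rw [if_neg hc]
      split_ifs with hx
      · by_contra hne
        exact hx 0 h0 (h2 c (MvPolynomial.mem_support_iff.2 hne) (Ne.symm hc))
      · rfl

/-- The multiplicative set `S_<` of the polynomials with leading part `1`. -/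
def unitSubmonoid {n : ℕ} (k : Type*) [Field k] {lt : (Fin n →₀ ℕ) → (Fin n →₀ ℕ) → Prop}
    (h : IsMonomialPreorder lt) : Submonoid (MvPolynomial (Fin n) k) where
  carrier := {u | leadingPart lt u = 1}
  one_mem' := by
    classical
    refine (leadingPart_eq_one_iff h 1).2 ⟨by simp, fun a ha hne => ?_⟩
    rw [MvPolynomial.mem_support_iff, MvPolynomial.coeff_one, if_neg (Ne.symm hne)] at ha
    exact absurd rfl ha
  mul_mem' := by
    classical
    intro u v hu hv
    have := h.weakOrder
    obtain ⟨hu1, hu2⟩ := (leadingPart_eq_one_iff h u).1 hu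
    obtain ⟨hv1, hv2⟩ := (leadingPart_eq_one_iff h v).1 hv
    refine (leadingPart_eq_one_iff h (u * v)).2 ⟨?_, fun c hc hne => ?_⟩
    · have hm := map_mul MvPolynomial.constantCoeff u v
      simp only [MvPolynomial.constantCoeff_eq] at hm
      rw [hm, hu1, hv1, one_mul]
    · obtain ⟨a, ha, b, hb, rfl⟩ := Finset.mem_add.1 (MvPolynomial.support_mul u v hc)
      by_cases ha0 : a = 0
      · subst ha0
        rw [zero_add] at hne ⊢
        exact hv2 b hb hne
      · by_cases hb0 : b = 0
        · subst hb0
          rw [add_zero] at hne ⊢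
          exact hu2 a ha hne
        · have h1 := h.compatible a 0 b (hu2 a ha ha0)
          rw [zero_add] at h1
          exact _root_.trans h1 (hv2 b hb hb0)

/-- Multiplication by an element of `S_<` does not change the leading part. -/
theorem leadingPart_unit_mul {n : ℕ} {k : Type*} [Field k]
    {lt : (Fin n →₀ ℕ) → (Fin n →₀ ℕ) → Prop} (h : IsMonomialPreorder lt)
    {u : MvPolynomial (Fin n) k} (hu : u ∈ unitSubmonoid k h) (g : MvPolynomial (Fin n) k) :
    leadingPart lt (u * g) = leadingPart lt g := by
  classical
  have := h.weakOrder
  obtain ⟨hu1, hu2⟩ := (leadingPart_eq_one_iff h u).1 hu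
  have hco : ∀ c, (∀ b ∈ g.support, ¬ lt c b) → (u * g).coeff c = g.coeff c := by
    intro c hc
    rw [MvPolynomial.coeff_mul, Finset.sum_eq_single (0, c)]
    · rw [hu1, one_mul]
    · rintro ⟨a, b⟩ hab hne
      rw [Finset.HasAntidiagonal.mem_antidiagonal] at hab
      simp only at hab ⊢
      by_contra hz
      have ha := MvPolynomial.mem_support_iff.2 (left_ne_zero_of_mul hz)
      have hb := MvPolynomial.mem_support_iff.2 (right_ne_zero_of_mul hz)
      have ha0 : a ≠ 0 := by
        rintro rfl
        rw [zero_add] at hab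
        exact hne (by rw [hab])
      have h1 := h.compatible a 0 b (hu2 a ha ha0)
      rw [zero_add, hab] at h1
      exact hc b hb h1
    · intro hn
      exact absurd (Finset.HasAntidiagonal.mem_antidiagonal.2 (zero_add c)) hn
  have hmx : ∀ c, (∀ b ∈ (u * g).support, ¬ lt c b) ↔ ∀ b ∈ g.support, ¬ lt c b := by
    intro c
    constructor
    · intro H b hb hcb
      obtain ⟨m, hm, hcm, hmm⟩ := exists_maximal_of_lt h g.support hb hcb
      refine H m ?_ hcm
      rw [MvPolynomial.mem_support_iff, hco m hmm]
      exact MvPolynomial.mem_support_iff.1 hm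
    · intro H b hb hcb
      obtain ⟨a, ha, d, hd, rfl⟩ := Finset.mem_add.1 (MvPolynomial.support_mul u g hb)
      by_cases ha0 : a = 0
      · subst ha0
        rw [zero_add] at hcb
        exact H d hd hcb
      · have h1 := h.compatible a 0 d (hu2 a ha ha0)
        rw [zero_add] at h1
        exact H d hd (_root_.trans hcb h1)
  ext c
  rw [coeff_leadingPart, coeff_leadingPart]
  simp only [hmx c]
  split_ifs with hc
  · exact hco c hc
  · rfl

/-- The localization `k[X]_< = S_<⁻¹ k[X]`. -/
abbrev LocalizedRing {n : ℕ} (k : Type*) [Field k] {lt : (Fin n →₀ ℕ) → (Fin n →₀ ℕ) → Prop}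
    (h : IsMonomialPreorder lt) : Type _ :=
  Localization (unitSubmonoid k h)

/-- The leading part of an element `f` of `k[X]_<`: if `f = g / u` with `u ∈ S_<`, it is the
leading part of the polynomial `g = u f`. -/
noncomputable def locLeadingPart {n : ℕ} {k : Type*} [Field k]
    {lt : (Fin n →₀ ℕ) → (Fin n →₀ ℕ) → Prop} (h : IsMonomialPreorder lt)
    (f : LocalizedRing k h) : MvPolynomial (Fin n) k :=
  Localization.liftOn f (fun g _ => leadingPart lt g) (by
    intro a c b d hr
    obtain ⟨s, hs⟩ := Localization.r_iff_exists.1 hr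
    have h1 := congrArg (leadingPart lt) hs
    simpa only [leadingPart_unit_mul h s.2, leadingPart_unit_mul h d.2,
      leadingPart_unit_mul h b.2] using h1)

/-- The leading part of `f` is the leading part of `u f` for every `u ∈ S_<` for which `u f` is a
polynomial. -/
theorem locLeadingPart_eq {n : ℕ} {k : Type*} [Field k]
    {lt : (Fin n →₀ ℕ) → (Fin n →₀ ℕ) → Prop} (h : IsMonomialPreorder lt)
    (f : LocalizedRing k h) {u g : MvPolynomial (Fin n) k} (hu : u ∈ unitSubmonoid k h)
    (hf : algebraMap (MvPolynomial (Fin n) k) (LocalizedRing k h) u * f =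
      algebraMap (MvPolynomial (Fin n) k) (LocalizedRing k h) g) :
    locLeadingPart h f = leadingPart lt g := by
  have h1 : f = Localization.mk g ⟨u, hu⟩ := by
    rw [Localization.mk_eq_mk', IsLocalization.eq_mk'_iff_mul_eq, mul_comm]
    exact hf
  rw [h1]
  rfl

/-- The leading ideal `L_<(G)` of a subset `G` of `k[X]_<`: the ideal of `k[X]` generated by the
leading parts of the elements of `G`. -/
noncomputable def leadingIdeal {n : ℕ} {k : Type*} [Field k]
    {lt : (Fin n →₀ ℕ) → (Fin n →₀ ℕ) → Prop} (h : IsMonomialPreorder lt)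
    (G : Set (LocalizedRing k h)) : Ideal (MvPolynomial (Fin n) k) :=
  Ideal.span (locLeadingPart h '' G)

/-- A standard basis of an ideal `I` of `k[X]_<`: a finite set of elements of `I` with the same
leading ideal as `I`. -/
structure IsStandardBasis {n : ℕ} {k : Type*} [Field k]
    {lt : (Fin n →₀ ℕ) → (Fin n →₀ ℕ) → Prop} (h : IsMonomialPreorder lt)
    (G : Set (LocalizedRing k h)) (I : Ideal (LocalizedRing k h)) : Prop where
  finite : G.Finite
  subset : G ⊆ (I : Set (LocalizedRing k h))
  leadingIdeal_eq : leadingIdeal h G = leadingIdeal h (I : Set (LocalizedRing k h))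

end MonomialPreorder

namespace MonomialPreorder

variable {n : ℕ} {k : Type*} [Field k] {lt : (Fin n →₀ ℕ) → (Fin n →₀ ℕ) → Prop}

theorem not_lt_trans (h : IsMonomialPreorder lt) {a b c : Fin n →₀ ℕ}
    (hab : ¬ lt a b) (hbc : ¬ lt b c) : ¬ lt a c := by
  have := h.weakOrder
  intro hac
  have hba : ¬ lt b a := fun hba => hbc (_root_.trans hba hac)
  have hcb : ¬ lt c b := fun hcb => hab (_root_.trans hac hcb)
  exact (IsStrictWeakOrder.incomp_trans a b c ⟨hab, hba⟩ ⟨hbc, hcb⟩).1 hac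

/-- Every finite nonempty set of exponents has a minimal element. -/
theorem exists_minimal_of_finite {r : (Fin n →₀ ℕ) → (Fin n →₀ ℕ) → Prop}
    [IsStrictOrder (Fin n →₀ ℕ) r] {s : Set (Fin n →₀ ℕ)} (hs : s.Finite) (hne : s.Nonempty) :
    ∃ m ∈ s, ∀ a ∈ s, ¬ r a m := by
  obtain ⟨x, hx⟩ := hne
  obtain ⟨m, -, hm⟩ := (hs.wellFoundedOn (r := r)).has_min Set.univ ⟨⟨x, hx⟩, trivial⟩
  exact ⟨m, m.2, fun a ha => hm ⟨a, ha⟩ trivial⟩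

/-! ### Lexicographic refinement and leading exponents. -/

/-- The refinement of a monomial preorder by the lexicographic order. -/
def lexRefinement (lt : (Fin n →₀ ℕ) → (Fin n →₀ ℕ) → Prop) (a b : Fin n →₀ ℕ) : Prop :=
  lt a b ∨ (¬ lt b a ∧ toLex a < toLex b)

theorem lexRefinement_isStrictOrder (h : IsMonomialPreorder lt) :
    IsStrictOrder (Fin n →₀ ℕ) (lexRefinement lt) where
  irrefl a := by
    have := h.weakOrder
    rintro (ha | ⟨-, ha⟩)
    · exact irrefl a ha
    · exact lt_irrefl _ ha
  trans a b c := by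
    have := h.weakOrder
    rintro (hab | ⟨hab, hab'⟩) (hbc | ⟨hbc, hbc'⟩)
    · exact Or.inl (_root_.trans hab hbc)
    · exact Or.inl (by_contra fun hac => not_lt_trans h hac hbc hab)
    · exact Or.inl (by_contra fun hac => not_lt_trans h hab hac hbc)
    · exact Or.inr ⟨not_lt_trans h hbc hab, hab'.trans hbc'⟩

theorem lexRefinement_or_of_ne {a b : Fin n →₀ ℕ} (hab : a ≠ b) :
    lexRefinement lt a b ∨ lexRefinement lt b a := by
  by_cases h1 : lt a b
  · exact Or.inl (Or.inl h1)
  by_cases h2 : lt b a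
  · exact Or.inr (Or.inl h2)
  rcases lt_or_gt_of_ne (fun h => hab (toLex_inj.1 h) : toLex a ≠ toLex b) with h3 | h3
  · exact Or.inl (Or.inr ⟨h2, h3⟩)
  · exact Or.inr (Or.inr ⟨h1, h3⟩)

theorem not_lt_of_lexRefinement (h : IsMonomialPreorder lt) {a b : Fin n →₀ ℕ}
    (hab : lexRefinement lt a b) : ¬ lt b a := by
  have := h.weakOrder
  rcases hab with hab | hab
  · exact fun hba => irrefl a (_root_.trans hab hba)
  · exact hab.1

/-- Cancellativity is what keeps a tie for `lt` from being broken by translation. -/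
theorem lexRefinement_add (h : IsMonomialPreorder lt) {a b : Fin n →₀ ℕ}
    (hab : lexRefinement lt a b) (c : Fin n →₀ ℕ) : lexRefinement lt (c + a) (c + b) := by
  rcases hab with hab | ⟨hab, hab'⟩
  · rw [add_comm c, add_comm c]
    exact Or.inl (h.compatible a b c hab)
  · refine Or.inr ⟨fun hba => hab (h.cancellative b a c ?_), ?_⟩
    · rwa [add_comm b, add_comm a]
    · rw [toLex_add, toLex_add]
      exact add_lt_add_right hab' _

/-- `a` is the exponent of the leading monomial of `f` for the lexicographic refinement. -/
def IsLeadingExponent (lt : (Fin n →₀ ℕ) → (Fin n →₀ ℕ) → Prop) (f : MvPolynomial (Fin n) k)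
    (a : Fin n →₀ ℕ) : Prop :=
  a ∈ f.support ∧ ∀ b ∈ f.support, b ≠ a → lexRefinement lt b a

theorem exists_isLeadingExponent (h : IsMonomialPreorder lt) {f : MvPolynomial (Fin n) k}
    (hf : f ≠ 0) : ∃ a, IsLeadingExponent lt f a := by
  have := lexRefinement_isStrictOrder h
  obtain ⟨a, ha, hmax⟩ := exists_minimal_of_finite (r := Function.swap (lexRefinement lt))
    f.support.finite_toSet (Finset.coe_nonempty.2 (MvPolynomial.support_nonempty.2 hf))
  exact ⟨a, ha, fun b hb hne => (lexRefinement_or_of_ne hne).resolve_right (hmax b hb)⟩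

theorem IsLeadingExponent.not_lt (h : IsMonomialPreorder lt) {f : MvPolynomial (Fin n) k}
    {a b : Fin n →₀ ℕ} (ha : IsLeadingExponent lt f a) (hb : b ∈ f.support) : ¬ lt a b := by
  have := h.weakOrder
  by_cases hba : b = a
  · subst hba
    exact irrefl b
  · exact not_lt_of_lexRefinement h (ha.2 b hb hba)

/-- Cancelling the leading terms of `f` and of a monomial multiple of `g` lowers the leading
exponent. -/
theorem lexRefinement_of_mem_support_sub (h : IsMonomialPreorder lt)
    {f g : MvPolynomial (Fin n) k} {m b : Fin n →₀ ℕ} (hf : IsLeadingExponent lt f (m + b))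
    (hg : IsLeadingExponent lt g b) {c : Fin n →₀ ℕ}
    (hc : c ∈ (f - MvPolynomial.monomial m (f.coeff (m + b) / g.coeff b) * g).support) :
    lexRefinement lt c (m + b) := by
  classical
  have hgb := MvPolynomial.mem_support_iff.1 hg.1
  have hne : c ≠ m + b := by
    rintro rfl
    rw [MvPolynomial.mem_support_iff, MvPolynomial.coeff_sub, MvPolynomial.coeff_monomial_mul,
      div_mul_cancel₀ _ hgb, sub_self] at hc
    exact hc rfl
  rcases Finset.mem_union.1 (MvPolynomial.support_sub _ _ _ hc) with hc | hc
  · exact hf.2 c hc hne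
  · obtain ⟨x, hx, y, hy, rfl⟩ := Finset.mem_add.1 (MvPolynomial.support_mul _ _ hc)
    obtain rfl := Finset.mem_singleton.1 (MvPolynomial.support_monomial_subset hx)
    exact lexRefinement_add h (hg.2 y hy fun hyb => hne (by rw [hyb])) _

/-! ### Termination of Mora division. -/

/-- Termination of Mora's division algorithm: if every element of `E` can be replaced by one with
strictly smaller monomials, and if `E` is stable under subtracting multiples by monomials below `1`
of its elements, then `E` is empty or contains `0`. -/
theorem zero_mem_of_reducible (h : IsMonomialPreorder lt) {E : Set (MvPolynomial (Fin n) k)}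
    (hne : E.Nonempty)
    (hred : ∀ f ∈ E, ∀ a ∈ f.support, (∀ b ∈ f.support, ¬ lt a b) →
      ∃ g ∈ E, ∀ b ∈ g.support, lt b a)
    (hsub : ∀ f ∈ E, ∀ g ∈ E, ∀ m, lt m 0 → ∀ c : k, f - MvPolynomial.monomial m c * g ∈ E) :
    (0 : MvPolynomial (Fin n) k) ∈ E := by
  classical
  have := h.weakOrder
  have := lexRefinement_isStrictOrder h
  by_contra h0
  have hlead : ∀ f ∈ E, ∃ a, IsLeadingExponent lt f a := fun f hf =>
    exists_isLeadingExponent h fun hf0 => h0 (hf0 ▸ hf)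
  -- The second coordinate is the écart of `f`.
  let A : Set ((Fin n →₀ ℕ) × ℕ) := {p | ∃ f ∈ E, IsLeadingExponent lt f p.1 ∧
    f.totalDegree = p.1.degree + p.2}
  have hA : ∀ f ∈ E, ∀ a, IsLeadingExponent lt f a → ∃ e, (a, e) ∈ A ∧
      f.totalDegree = a.degree + e := by
    intro f hf a ha
    have hdeg : a.degree ≤ f.totalDegree := MvPolynomial.le_totalDegree ha.1
    obtain ⟨e, he⟩ := Nat.exists_eq_add_of_le hdeg
    exact ⟨e, ⟨f, hf, ha, he⟩, he⟩
  -- Dickson's lemma: `A` has finitely many minimal elements, and each element of `A` dominates one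
  -- of them.
  have hpwo : A.IsPWO := Set.isPWO_of_wellQuasiOrderedLE A
  let T : Set ((Fin n →₀ ℕ) × ℕ) := {p | Minimal (· ∈ A) p}
  have hT : T.Finite := (setOfPred_minimal_antichain _).finite_of_partiallyWellOrderedOn
    (hpwo.mono fun p hp => hp.prop)
  have hTle : ∀ p ∈ A, ∃ q ∈ T, q ≤ p := fun p hp => by
    obtain ⟨q, hq, hq'⟩ := hpwo.exists_le_minimal hp
    exact ⟨q, hq', hq⟩
  -- an element of `E` all of whose monomials lie below those of the minimal elements of `A`
  obtain ⟨g, hg, hgT⟩ : ∃ g ∈ E, ∀ b ∈ g.support, ∀ q ∈ T, lt b q.1 := by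
    obtain ⟨f, hf⟩ := hne
    obtain ⟨a, ha⟩ := hlead f hf
    obtain ⟨e, he, -⟩ := hA f hf a ha
    obtain ⟨q, hq, -⟩ := hTle _ he
    -- With `p` lowest in `T` for `lt`, falling below `p` means falling below all of `T`.
    obtain ⟨-, ⟨p, hp, rfl⟩, hmin⟩ := exists_minimal_of_finite (r := lt) (hT.image Prod.fst)
      ⟨q.1, q, hq, rfl⟩
    obtain ⟨t, ht, hpt, -⟩ := Minimal.prop hp
    obtain ⟨g, hg, hgt⟩ := hred t ht p.1 hpt.1 fun b hb => hpt.not_lt h hb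
    exact ⟨g, hg, fun b hb q hq => by_contra fun hbq =>
      not_lt_trans h hbq (hmin q.1 ⟨q, hq, rfl⟩) (hgt b hb)⟩
  -- The degree bound makes `B` finite, which replaces well-foundedness; lying below `T` makes every
  -- quotient monomial smaller than 1.
  let B : Set (Fin n →₀ ℕ) := {a | ∃ f ∈ E, IsLeadingExponent lt f a ∧
    f.totalDegree ≤ g.totalDegree ∧ ∀ q ∈ T, lt a q.1}
  have hB : B.Finite := (Finsupp.finite_of_degree_le g.totalDegree).subset fun a ha => by
    obtain ⟨f, -, ha, hd, -⟩ := ha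
    exact (MvPolynomial.le_totalDegree ha.1).trans hd
  have hBne : B.Nonempty := by
    obtain ⟨a, ha⟩ := hlead g hg
    exact ⟨a, g, hg, ha, le_rfl, hgT a ha.1⟩
  obtain ⟨a, ⟨f, hf, ha, hd, hlt⟩, hmin⟩ := exists_minimal_of_finite (r := lexRefinement lt) hB hBne
  obtain ⟨e, he, hfe⟩ := hA f hf a ha
  obtain ⟨⟨b, e'⟩, hq, hle⟩ := hTle _ he
  obtain ⟨t, ht, hb, hte⟩ := hq.prop
  obtain ⟨m, rfl⟩ := exists_add_of_le hle.1
  have hee : e' ≤ e := hle.2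
  have hab := hlt _ hq
  simp only at hb hte ha hfe hab hmin hlt
  rw [add_comm b m] at *
  have hm : lt m 0 := h.cancellative m 0 b (by rwa [zero_add])
  have hfE := hsub f hf t ht m hm (f.coeff (m + b) / t.coeff b)
  obtain ⟨c, hc⟩ := hlead _ hfE
  have hcm := lexRefinement_of_mem_support_sub h ha hb hc.1
  refine hmin c ⟨_, hfE, hc, ?_, fun q hq => ?_⟩ hcm
  -- The subtracted multiple has degree at most |m| + |b| + e' ≤ |m + b| + e = deg f, by the
  -- comparison of écarts.
  · refine (MvPolynomial.totalDegree_sub _ _).trans (max_le hd (le_trans ?_ hd))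
    refine (MvPolynomial.totalDegree_mul _ _).trans ?_
    have h1 : (MvPolynomial.monomial m (f.coeff (m + b) / t.coeff b)).totalDegree ≤ m.degree :=
      MvPolynomial.totalDegree_monomial_le _ _
    have h2 : (m + b).degree = m.degree + b.degree := map_add _ _ _
    omega
  · exact by_contra fun hcq => not_lt_trans h (not_lt_of_lexRefinement h hcm) hcq (hlt q hq)

/-! ### Components of the leading ideal. -/

/-- The homogeneous components of an element of the ideal generated by the leading parts of the
elements of `J` are leading components of elements of `J`. -/
theorem exists_component_of_mem_span (h : IsMonomialPreorder lt)
    {J : Ideal (MvPolynomial (Fin n) k)} {p : MvPolynomial (Fin n) k}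
    (hp : p ∈ Ideal.span (leadingPart lt '' (J : Set (MvPolynomial (Fin n) k))))
    (a : Fin n →₀ ℕ) :
    ∃ g ∈ J, (∀ b ∈ g.support, ¬ lt a b) ∧ ∀ b, ¬ lt a b → ¬ lt b a → g.coeff b = p.coeff b := by
  classical
  have := h.weakOrder
  induction hp using Submodule.span_induction generalizing a with
  | mem p hp =>
    obtain ⟨g, hg, rfl⟩ := hp
    -- A leading part lives in a single incomparability class, so its component at `a` is all of it
    -- or 0.
    by_cases hex : ∃ d ∈ (leadingPart lt g).support, ¬ lt a d ∧ ¬ lt d a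
    · obtain ⟨d, hd, had, hda⟩ := hex
      rw [MvPolynomial.mem_support_iff, coeff_leadingPart] at hd
      have hmax : ∀ b ∈ g.support, ¬ lt d b := by
        by_contra hn
        exact hd (if_neg hn)
      refine ⟨g, hg, fun b hb => not_lt_trans h had (hmax b hb), fun b hab hba => ?_⟩
      rw [coeff_leadingPart, if_pos]
      exact fun c hc => not_lt_trans h (not_lt_trans h hba had) (hmax c hc)
    · refine ⟨0, J.zero_mem, by simp, fun b hab hba => ?_⟩
      by_contra hb
      exact hex ⟨b, MvPolynomial.mem_support_iff.2 (Ne.symm hb), hab, hba⟩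
  | zero => exact ⟨0, J.zero_mem, by simp, fun _ _ _ => rfl⟩
  | add p q _ _ ihp ihq =>
    obtain ⟨f, hf, hf1, hf2⟩ := ihp a
    obtain ⟨g, hg, hg1, hg2⟩ := ihq a
    refine ⟨f + g, J.add_mem hf hg, fun b hb => ?_, fun b hab hba => ?_⟩
    · rcases Finset.mem_union.1 (MvPolynomial.support_add hb) with hb | hb
      exacts [hf1 b hb, hg1 b hb]
    · rw [MvPolynomial.coeff_add, MvPolynomial.coeff_add, hf2 b hab hba, hg2 b hab hba]
  | smul r p _ ih =>
    rw [smul_eq_mul]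
    induction r using MvPolynomial.induction_on' generalizing a with
    | add r s ihr ihs =>
      obtain ⟨f, hf, hf1, hf2⟩ := ihr a
      obtain ⟨g, hg, hg1, hg2⟩ := ihs a
      refine ⟨f + g, J.add_mem hf hg, fun b hb => ?_, fun b hab hba => ?_⟩
      · rcases Finset.mem_union.1 (MvPolynomial.support_add hb) with hb | hb
        exacts [hf1 b hb, hg1 b hb]
      · rw [add_mul, MvPolynomial.coeff_add, MvPolynomial.coeff_add, hf2 b hab hba,
          hg2 b hab hba]
    | monomial m c =>
      -- Multiplication by x^m carries the class of `d` into that of `a`; cancellativity ensures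
      -- that no other class lands there.
      by_cases hex : ∃ d, ¬ lt a (m + d) ∧ ¬ lt (m + d) a
      · obtain ⟨d, had, hda⟩ := hex
        obtain ⟨g, hg, hg1, hg2⟩ := ih d
        refine ⟨MvPolynomial.monomial m c * g, J.mul_mem_left _ hg, fun b hb => ?_,
          fun b hab hba => ?_⟩
        · obtain ⟨x, hx, y, hy, rfl⟩ := Finset.mem_add.1 (MvPolynomial.support_mul _ _ hb)
          obtain rfl := Finset.mem_singleton.1 (MvPolynomial.support_monomial_subset hx)
          refine not_lt_trans h had fun hlt => hg1 y hy (h.cancellative d y x ?_)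
          rwa [add_comm d, add_comm y]
        · rw [MvPolynomial.coeff_monomial_mul', MvPolynomial.coeff_monomial_mul']
          split_ifs with hmb
          · obtain ⟨y, rfl⟩ := exists_add_of_le hmb
            rw [add_tsub_cancel_left, hg2 y]
            · intro hlt
              have := h.compatible d y m hlt
              rw [add_comm d, add_comm y] at this
              exact not_lt_trans h hda hab this
            · intro hlt
              have := h.compatible y d m hlt
              rw [add_comm d, add_comm y] at this
              exact not_lt_trans h hba had this
          · rfl
      · refine ⟨0, J.zero_mem, by simp, fun b hab hba => ?_⟩
        rw [MvPolynomial.coeff_monomial_mul', if_neg]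
        · rfl
        · intro hmb
          obtain ⟨y, rfl⟩ := exists_add_of_le hmb
          exact hex ⟨y, hab, hba⟩

/-- If the leading part of `f` lies in the ideal generated by the leading parts of the elements
of `J`, then subtracting an element of `J` from `f` removes its leading part. -/
theorem exists_sub_lt (h : IsMonomialPreorder lt) {J : Ideal (MvPolynomial (Fin n) k)}
    {f : MvPolynomial (Fin n) k}
    (hf : leadingPart lt f ∈ Ideal.span (leadingPart lt '' (J : Set (MvPolynomial (Fin n) k))))
    {a : Fin n →₀ ℕ} (hmax : ∀ b ∈ f.support, ¬ lt a b) :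
    ∃ g ∈ J, ∀ b ∈ (f - g).support, lt b a := by
  classical
  obtain ⟨g, hg, hg1, hg2⟩ := exists_component_of_mem_span h hf a
  refine ⟨g, hg, fun b hb => ?_⟩
  by_contra hba
  have hab : ¬ lt a b := by
    rcases Finset.mem_union.1 (MvPolynomial.support_sub _ _ _ hb) with hb | hb
    exacts [hmax b hb, hg1 b hb]
  rw [MvPolynomial.mem_support_iff, MvPolynomial.coeff_sub, hg2 b hab hba, coeff_leadingPart,
    if_pos fun c hc => not_lt_trans h hba (hmax c hc), sub_self] at hb
  exact hb rfl

/-! ### Units and passage to the localization. -/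

theorem sub_monomial_mul_mem_unitSubmonoid (h : IsMonomialPreorder lt)
    {u v : MvPolynomial (Fin n) k} (hu : u ∈ unitSubmonoid k h) (hv : v ∈ unitSubmonoid k h)
    {m : Fin n →₀ ℕ} (hm : lt m 0) (c : k) :
    u - MvPolynomial.monomial m c * v ∈ unitSubmonoid k h := by
  classical
  have := h.weakOrder
  obtain ⟨hu1, hu2⟩ := (leadingPart_eq_one_iff h u).1 hu
  obtain ⟨-, hv2⟩ := (leadingPart_eq_one_iff h v).1 hv
  have key : ∀ b ∈ (MvPolynomial.monomial m c * v).support, lt b 0 := by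
    intro b hb
    obtain ⟨x, hx, y, hy, rfl⟩ := Finset.mem_add.1 (MvPolynomial.support_mul _ _ hb)
    obtain rfl := Finset.mem_singleton.1 (MvPolynomial.support_monomial_subset hx)
    by_cases hy0 : y = 0
    · rwa [hy0, add_zero]
    · have h1 := h.compatible x 0 y hm
      rw [zero_add] at h1
      exact _root_.trans h1 (hv2 y hy hy0)
  refine (leadingPart_eq_one_iff h _).2 ⟨?_, fun b hb hb0 => ?_⟩
  · rw [MvPolynomial.coeff_sub, hu1, MvPolynomial.notMem_support_iff.1 fun h0 =>
      irrefl (0 : Fin n →₀ ℕ) (key 0 h0), sub_zero]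
  · rcases Finset.mem_union.1 (MvPolynomial.support_sub _ _ _ hb) with hb | hb
    exacts [hu2 b hb hb0, key b hb]

/-- Ideals `J ≤ I` of `k[X]` with the same leading ideal agree after localization. -/
theorem exists_unit_mul_mem (h : IsMonomialPreorder lt) {J I : Ideal (MvPolynomial (Fin n) k)}
    (hJI : J ≤ I)
    (hL : ∀ f ∈ I, leadingPart lt f ∈
      Ideal.span (leadingPart lt '' (J : Set (MvPolynomial (Fin n) k))))
    {f : MvPolynomial (Fin n) k} (hf : f ∈ I) : ∃ u ∈ unitSubmonoid k h, u * f ∈ J := by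
  have key := zero_mem_of_reducible h (E := {r | ∃ u ∈ unitSubmonoid k h, u * f - r ∈ J})
    ⟨f, 1, one_mem _, by simp⟩ ?_ ?_
  · obtain ⟨u, hu, huf⟩ := key
    exact ⟨u, hu, by simpa using huf⟩
  · rintro r ⟨u, hu, hr⟩ a - hmax
    have hrI : r ∈ I := by
      have := I.sub_mem (I.mul_mem_left u hf) (hJI hr)
      rwa [sub_sub_cancel] at this
    obtain ⟨g, hg, hlt⟩ := exists_sub_lt h (hL r hrI) hmax
    refine ⟨r - g, ⟨u, hu, ?_⟩, hlt⟩
    have := J.add_mem hr hg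
    rwa [sub_add] at this
  · rintro r ⟨u, hu, hr⟩ s ⟨v, hv, hs⟩ m hm c
    refine ⟨_, sub_monomial_mul_mem_unitSubmonoid h hu hv hm c, ?_⟩
    have := J.sub_mem hr (J.mul_mem_left (MvPolynomial.monomial m c) hs)
    convert this using 1
    ring

/-- Clearing a denominator from S_< changes neither membership in `I` nor the leading part. -/
theorem leadingIdeal_eq_span_comap (h : IsMonomialPreorder lt) (I : Ideal (LocalizedRing k h)) :
    leadingIdeal h (I : Set (LocalizedRing k h)) =
      Ideal.span (leadingPart lt '' (I.comap (algebraMap (MvPolynomial (Fin n) k)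
        (LocalizedRing k h)) : Set (MvPolynomial (Fin n) k))) := by
  rw [leadingIdeal]
  congr 1
  ext p
  constructor
  · rintro ⟨f, hf, rfl⟩
    obtain ⟨g, u, hu⟩ := IsLocalization.exists_mk'_eq (unitSubmonoid k h) f
    have hug : algebraMap (MvPolynomial (Fin n) k) (LocalizedRing k h) u * f =
        algebraMap (MvPolynomial (Fin n) k) (LocalizedRing k h) g := by
      rw [← hu, IsLocalization.mk'_spec']
    refine ⟨g, ?_, (locLeadingPart_eq h f u.2 hug).symm⟩
    rw [SetLike.mem_coe, Ideal.mem_comap, ← hug]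
    exact I.mul_mem_left _ hf
  · rintro ⟨g, hg, rfl⟩
    exact ⟨algebraMap _ _ g, hg, locLeadingPart_eq h _ (one_mem _) (by rw [map_one, one_mul])⟩

theorem eq_of_leadingIdeal_eq (h : IsMonomialPreorder lt) {J I : Ideal (LocalizedRing k h)}
    (hJI : J ≤ I) (hL : leadingIdeal h (J : Set (LocalizedRing k h)) =
      leadingIdeal h (I : Set (LocalizedRing k h))) : J = I := by
  refine le_antisymm hJI ?_
  rw [leadingIdeal_eq_span_comap, leadingIdeal_eq_span_comap] at hL
  -- An ideal of a localization is the extension of its contraction, so polynomials in `I` suffice.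
  rw [← IsLocalization.map_under (unitSubmonoid k h) (LocalizedRing k h) I,
    Ideal.map_le_iff_le_comap]
  intro f hf
  obtain ⟨u, hu, huf⟩ := exists_unit_mul_mem h (Ideal.comap_mono hJI)
    (fun g hg => hL ▸ Ideal.subset_span ⟨g, hg, rfl⟩) hf
  rw [Ideal.mem_comap, map_mul] at huf
  exact (Ideal.unit_mul_mem_iff_mem J
    (IsLocalization.map_units (LocalizedRing k h) (⟨u, hu⟩ : unitSubmonoid k h))).1 huf

end MonomialPreorder

theorem mainTheorem2 {n : ℕ} {k : Type*} [Field k]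
    (lt : (Fin n →₀ ℕ) → (Fin n →₀ ℕ) → Prop) (h : IsMonomialPreorder lt) :
    (∀ J I : Ideal (MonomialPreorder.LocalizedRing k h), J ≤ I →
      MonomialPreorder.leadingIdeal h (J : Set (MonomialPreorder.LocalizedRing k h)) =
        MonomialPreorder.leadingIdeal h (I : Set (MonomialPreorder.LocalizedRing k h)) →
      J = I) ∧
    (∀ (I : Ideal (MonomialPreorder.LocalizedRing k h))
      (G : Set (MonomialPreorder.LocalizedRing k h)),
      MonomialPreorder.IsStandardBasis h G I → Ideal.span G = I) := by
  refine ⟨fun J I hJI hL => MonomialPreorder.eq_of_leadingIdeal_eq h hJI hL, fun I G hG => ?_⟩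
  have hGI : Ideal.span G ≤ I := Ideal.span_le.2 hG.subset
  -- The leading ideal of `Ideal.span G` is squeezed between those of `G` and `I`, which agree.
  refine MonomialPreorder.eq_of_leadingIdeal_eq h hGI (le_antisymm ?_ ?_)
  · exact Ideal.span_mono (Set.image_mono hGI)
  · rw [← hG.leadingIdeal_eq]
    exact Ideal.span_mono (Set.image_mono Ideal.subset_span)
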